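/- All graphs are finite and simple. An ordered graph is a graph together with a linear ordering of its vertex set; a copy of an ordered graph $H$ in an ordered graph $F$ is a (not necessarily induced) subgraph of $F$ that is isomorphic to $H$ by an order-preserving map. For ordered graphs $H,H'$ let $R_<(H,H')$ be the set of all ordered graphs $F$ such that every coloring of the edges of $F$ in red and blue contains a copy of $H$ with all edges red or a copy of $H'$ with all edges blue. The density of a graph $G$ is $m(G)=\max\{|E(G')|/|V(G')| : G'\subseteq G,\ V(G')\neq\emptyset\}$, and $r^m_<(H,H')=\inf\{m(F) : F\in R_<(H,H')\}$. A pseudoforest is a graph $G$ with $m(G)\le 1$; it is proper if $m(G)=1$. A monotone $P_3$ is a path $u_1u_2u_3$ on three vertices with $u_1<u_2<u_3$. Theorem. Let $H$ and $H'$ be connected ordered graphs with at least one edge each. Then the following are equivalent: (a) $r^m_<(H,H')=1$ and $R_<(H,H')$ contains an ordered pseudoforest; (b) one of $H,H'$ is $K_2$ and the other is a (connected) ordered proper pseudoforest, or both $H$ and $H'$ are a monotone $P_3$. -/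

import Mathlib

/-! An *ordered graph* is a `SimpleGraph V` on a finite linearly ordered vertex type `V`. -/

/-- A copy of the ordered graph `H` in the ordered graph `F`: a (not necessarily induced) subgraph
of `F` that is isomorphic to `H` by an order-preserving map. -/
def OrderedContained {V W : Type*} [LinearOrder V] [LinearOrder W]
    (H : SimpleGraph V) (F : SimpleGraph W) : Prop :=
  ∃ f : V ↪o W, ∀ u v : V, H.Adj u v → F.Adj (f u) (f v)

/-- Isomorphism of ordered graphs. -/
def OrderedIso {V W : Type*} [LinearOrder V] [LinearOrder W]
    (G : SimpleGraph V) (H : SimpleGraph W) : Prop :=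
  ∃ f : V ≃o W, ∀ u v : V, G.Adj u v ↔ H.Adj (f u) (f v)

/-- `F → (H, H')`: every colouring of the edges of `F` in red (`true`) and blue (`false`) has
a copy of `H` with all edges red or a copy of `H'` with all edges blue. -/
def OrderedArrows {U V W : Type*} [LinearOrder U] [LinearOrder V] [LinearOrder W]
    (F : SimpleGraph U) (H : SimpleGraph V) (H' : SimpleGraph W) : Prop :=
  ∀ c : F.EdgeLabeling Bool,
    OrderedContained H (c.labelGraph true) ∨ OrderedContained H' (c.labelGraph false)

/-- `R_<(H, H')`, the set of ordered Ramsey graphs of `(H, H')`. Each finite ordered graph is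
represented by its unique isomorphic copy on the vertex set `{0 < 1 < ⋯ < n - 1}`. -/
def orderedRamseyGraphs {V W : Type*} [LinearOrder V] [LinearOrder W]
    (H : SimpleGraph V) (H' : SimpleGraph W) : Set (Σ n : ℕ, SimpleGraph (Fin n)) :=
  {F | OrderedArrows F.2 H H'}

/-- The density `m(G)` of a finite graph, the maximum of `|E(G')| / |V(G')|` over all subgraphs
`G'` of `G`. There are finitely many subgraphs, so the supremum is a maximum; the empty subgraph
contributes `0 / 0 = 0`, which does not affect it. -/
noncomputable def graphDensity {V : Type*} (G : SimpleGraph V) : ℝ :=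
  ⨆ G' : G.Subgraph, (G'.edgeSet.ncard : ℝ) / (G'.verts.ncard : ℝ)

/-- A pseudoforest is a graph of density at most `1`. -/
def IsPseudoforest {V : Type*} (G : SimpleGraph V) : Prop :=
  graphDensity G ≤ 1

/-- A proper pseudoforest is a graph of density exactly `1`. -/
def IsProperPseudoforest {V : Type*} (G : SimpleGraph V) : Prop :=
  graphDensity G = 1

/-- The ordered Ramsey density `r^m_<(H, H')`, the infimum of `m(F)` over `F` in `R_<(H, H')`. -/
noncomputable def orderedRamseyDensity {V W : Type*} [LinearOrder V] [LinearOrder W]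
    (H : SimpleGraph V) (H' : SimpleGraph W) : ℝ :=
  sInf ((fun F : Σ n : ℕ, SimpleGraph (Fin n) => graphDensity F.2) '' orderedRamseyGraphs H H')

/-- The ordered graph `G` is a `K_2`. -/
def IsOrderedK2 {V : Type*} [LinearOrder V] (G : SimpleGraph V) : Prop :=
  OrderedIso G (⊤ : SimpleGraph (Fin 2))

/-- The ordered graph `G` is a monotone `P_3`, that is, a path `u₀ u₁ u₂` with `u₀ < u₁ < u₂`. -/
def IsMonotoneP3 {V : Type*} [LinearOrder V] (G : SimpleGraph V) : Prop :=
  OrderedIso G (SimpleGraph.pathGraph 3)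

/-! An edge of an ordered graph is read from left to right. A connected ordered graph with at least
two edges contains a left cherry (a vertex with two neighbours to its left), a right cherry, or a
monotone `P_3`.

By Hall's theorem, a finite graph has density at most `1` if and only if some self-map `f` of its
vertex set makes every edge of the form `{v, f v}`. So an edge colouring of a pseudoforest can be
described in terms of `f`, with no reference to cycles. Four colourings rule out all pairs `(H, H')`
without `K_2` except for a pair of monotone `P_3`, given that no forest is a Ramsey graph:

* red edges `v < f v` and blue edges `f v < v` avoid a red right cherry and a blue left cherry;
* red edges where `f` turns (exactly one of `v < f v` and `f v < f (f v)` holds) and blue edges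
  where it does not avoid a red monotone `P_3` and a connected blue graph with both cherries.

Hence `H` and `H'` both lack right cherries or both lack left cherries, by symmetry the former.
If one of them had no monotone `P_3`, it would be a star whose centre is its last vertex, and a
blow-up of the other one would be a forest that is a Ramsey graph (`orderedArrows_blowUp`). Hence
both contain a monotone `P_3`.

* Let `S` be the set with `u ∈ S` if and only if `u < f u` and `f u ∉ S`. To colour an edge red if
  its left end is in `S` avoids a red monotone `P_3` and, in blue, each connected graph with a
  monotone `P_3` and a left cherry but no right cherry.
* A 2-colouring of the vertices that is proper except at one edge of each component, transferred to
  the edges by their left ends, avoids a red monotone `P_3` and a blue monotone `P_4`.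

So both graphs are monotone `P_3`. For this pair no bipartite graph is a Ramsey graph, since a
proper 2-colouring of the vertices can be transferred to the edges in the same way; so each Ramsey
graph has a cycle and density at least `1`, which `triangleWithTails` attains. If `H` is `K_2`, the
Ramsey graphs are exactly the graphs that contain `H'`. -/

/-! ### Density -/

theorem bddAbove_density {V : Type*} [Finite V] (G : SimpleGraph V) :
    BddAbove (Set.range fun G' : G.Subgraph =>
      (G'.edgeSet.ncard : ℝ) / (G'.verts.ncard : ℝ)) :=
  (Set.finite_range _).bddAbove

theorem le_graphDensity {V : Type*} [Finite V] (G : SimpleGraph V) (G' : G.Subgraph) :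
    (G'.edgeSet.ncard : ℝ) / (G'.verts.ncard : ℝ) ≤ graphDensity G :=
  le_ciSup (bddAbove_density G) G'

theorem graphDensity_nonneg {V : Type*} (G : SimpleGraph V) : 0 ≤ graphDensity G :=
  Real.iSup_nonneg fun _ => by positivity

/-- Copies do not decrease the density. -/
theorem OrderedContained.graphDensity_le {V W : Type*} [LinearOrder V] [LinearOrder W] [Finite V]
    [Finite W] {H : SimpleGraph V} {F : SimpleGraph W} (h : OrderedContained H F) :
    graphDensity H ≤ graphDensity F := by
  obtain ⟨f, hf⟩ := h
  let g : H →g F := ⟨f, fun {a b} hab => hf a b hab⟩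
  refine ciSup_le fun H' => ?_
  refine le_trans (le_of_eq ?_) (le_graphDensity F (H'.map g))
  have hv : (H'.map g).verts.ncard = H'.verts.ncard := by
    rw [SimpleGraph.Subgraph.map_verts]
    exact Set.ncard_image_of_injective _ f.injective
  have he : (H'.map g).edgeSet.ncard = H'.edgeSet.ncard := by
    rw [SimpleGraph.Subgraph.edgeSet_map]
    exact Set.ncard_image_of_injective _ (Sym2.map.injective f.injective)
  rw [hv, he]

/-- If every edge joins some vertex `v` to `f v`, then the number of edges of a subgraph is at most
the number of its vertices. -/
theorem graphDensity_le_one_of_map {V : Type*} [Finite V] {G : SimpleGraph V} (f : V → V)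
    (hf : ∀ u v, G.Adj u v → f u = v ∨ f v = u) : graphDensity G ≤ 1 := by
  refine ciSup_le fun G' => div_le_one_of_le₀ ?_ (Nat.cast_nonneg _)
  have hsub : G'.edgeSet ⊆ (fun u => s(u, f u)) '' G'.verts := by
    intro e
    induction e using Sym2.ind with
    | _ u v =>
      intro h
      rw [SimpleGraph.Subgraph.mem_edgeSet] at h
      rcases hf u v h.adj_sub with h1 | h1
      · exact ⟨u, h.fst_mem, by simp [h1]⟩
      · exact ⟨v, h.snd_mem, by simp [h1, Sym2.eq_swap]⟩
  exact_mod_cast (Set.ncard_le_ncard hsub).trans (Set.ncard_image_le)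

/-- In a graph of density at most one every edge can be assigned to one of its endpoints in such a
way that no vertex is used twice; `f v` is the other endpoint of the edge assigned to `v`, and
`f v = v` if there is none. This is Hall's theorem. -/
theorem IsPseudoforest.exists_map {V : Type*} [Finite V] {G : SimpleGraph V}
    (hG : IsPseudoforest G) : ∃ f : V → V, ∀ u v, G.Adj u v → f u = v ∨ f v = u := by
  classical
  have hall : ∀ s : Finset G.edgeSet,
      s.card ≤ (s.biUnion fun e => (e : Sym2 V).toFinset).card := by
    intro s
    let vs := s.biUnion fun e => (e : Sym2 V).toFinset
    let G' : G.Subgraph :=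
      { verts := vs
        Adj := fun u v => ∃ h : G.Adj u v, (⟨s(u, v), h⟩ : G.edgeSet) ∈ s
        adj_sub := fun h => h.1
        edge_vert := fun {u v} h => by
          simp only [vs, Finset.coe_biUnion, Set.mem_iUnion, Finset.mem_coe]
          exact ⟨_, h.2, by simp⟩
        symm := ⟨fun u v ⟨h, h'⟩ => ⟨h.symm, by
          have : (⟨s(v, u), h.symm⟩ : G.edgeSet) = ⟨s(u, v), h⟩ := Subtype.ext Sym2.eq_swap
          rwa [this]⟩⟩ }
    have he : G'.edgeSet = Subtype.val '' (s : Set G.edgeSet) := by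
      ext e
      induction e using Sym2.ind with
      | _ u v => simp [G']
    have hle := (le_graphDensity G G').trans hG
    have hec : G'.edgeSet.ncard = s.card := by
      rw [he, Set.ncard_image_of_injective _ Subtype.val_injective, Set.ncard_coe_finset]
    have hvc : G'.verts.ncard = vs.card := Set.ncard_coe_finset vs
    rw [hec, hvc] at hle
    rcases Nat.eq_zero_or_pos vs.card with h0 | h0
    · suffices s = ∅ by simp [this]
      rw [Finset.card_eq_zero] at h0
      by_contra hs
      obtain ⟨⟨e, he'⟩, hes⟩ := Finset.nonempty_iff_ne_empty.2 hs
      induction e using Sym2.ind with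
      | _ u v =>
        have : u ∈ vs := Finset.mem_biUnion.2 ⟨_, hes, by simp⟩
        simp [h0] at this
    · rw [div_le_one (by exact_mod_cast h0)] at hle
      exact_mod_cast hle
  obtain ⟨φ, hφ, hm⟩ :=
    (Finset.all_card_le_biUnion_card_iff_exists_injective _).1 hall
  refine ⟨fun v => if h : ∃ w, ∃ hw : G.Adj v w, φ ⟨s(v, w), hw⟩ = v then h.choose else v, ?_⟩
  -- the two endpoints may be exchanged, so let the edge `uv` be assigned to `u`
  have key : ∀ u v, ∀ h : G.Adj u v, φ ⟨s(u, v), h⟩ = u →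
      (if h : ∃ w, ∃ hw : G.Adj u w, φ ⟨s(u, w), hw⟩ = u then h.choose else u) = v := by
    intro u v h hu
    have hex : ∃ w, ∃ hw : G.Adj u w, φ ⟨s(u, w), hw⟩ = u := ⟨v, h, hu⟩
    rw [dif_pos hex]
    obtain ⟨hw, hw'⟩ := hex.choose_spec
    have := congrArg Subtype.val (hφ (hw'.trans hu.symm))
    exact Sym2.congr_right.1 this
  intro u v h
  have hmem := hm ⟨s(u, v), h⟩
  simp only [Sym2.mem_toFinset, Sym2.mem_iff] at hmem
  rcases hmem with h1 | h1
  · exact Or.inl (key u v h h1)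
  · refine Or.inr (key v u h.symm ?_)
    have : (⟨s(v, u), h.symm⟩ : G.edgeSet) = ⟨s(u, v), h⟩ := Subtype.ext Sym2.eq_swap
    exact (congrArg φ this).trans h1

/-- A graph that is not acyclic has density at least one. -/
theorem one_le_graphDensity_of_not_isAcyclic {V : Type*} [Finite V] {G : SimpleGraph V}
    (hG : ¬ G.IsAcyclic) : 1 ≤ graphDensity G := by
  classical
  simp only [SimpleGraph.IsAcyclic, not_forall, not_not] at hG
  obtain ⟨v, p, hp⟩ := hG
  refine le_trans (le_of_eq ?_) (le_graphDensity G p.toSubgraph)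
  have he : p.toSubgraph.edgeSet.ncard = p.length := by
    rw [← SimpleGraph.Walk.length_edges, ← List.toFinset_card_of_nodup hp.edges_nodup,
      ← Set.ncard_coe_finset]
    congr 1
    ext e
    simp
  have hv : p.toSubgraph.verts.ncard = p.length := by
    have hl : p.support.tail.length = p.length := by simp
    rw [← hl, ← List.toFinset_card_of_nodup hp.support_nodup, ← Set.ncard_coe_finset]
    congr 1
    ext x
    simp only [SimpleGraph.Walk.mem_verts_toSubgraph, List.coe_toFinset, Set.mem_ofPred_eq]
    refine ⟨fun hx => ?_, List.mem_of_mem_tail⟩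
    rw [SimpleGraph.Walk.mem_support_iff] at hx
    rcases hx with rfl | hx
    · exact SimpleGraph.Walk.end_mem_tail_support hp.not_nil
    · exact hx
  have hpos : 0 < p.length := by have := hp.three_le_length; omega
  rw [he, hv, div_self (by exact_mod_cast hpos.ne')]

/-! ### Cherries and monotone paths -/

/-- Some vertex has two neighbours to its left. -/
def HasLeftCherry {V : Type*} [LinearOrder V] (G : SimpleGraph V) : Prop :=
  ∃ a b c, a ≠ b ∧ a < c ∧ b < c ∧ G.Adj a c ∧ G.Adj b c

/-- Some vertex has two neighbours to its right. -/
def HasRightCherry {V : Type*} [LinearOrder V] (G : SimpleGraph V) : Prop :=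
  ∃ a b c, b ≠ c ∧ a < b ∧ a < c ∧ G.Adj a b ∧ G.Adj a c

/-- Some vertex has a neighbour to its left and a neighbour to its right, so the graph contains a
monotone `P_3`. -/
def HasMonotonePath {V : Type*} [LinearOrder V] (G : SimpleGraph V) : Prop :=
  ∃ a b c, a < b ∧ b < c ∧ G.Adj a b ∧ G.Adj b c

/-- A graph with at most one edge to the right of each vertex is a forest. The edges are counted by
their left endpoints, and the last vertex of a subgraph is not one of these. -/
theorem graphDensity_lt_one_of_not_hasRightCherry {V : Type*} [LinearOrder V] [Finite V]
    {G : SimpleGraph V} (h : ¬ HasRightCherry G) : graphDensity G < 1 := by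
  classical
  obtain ⟨G', hG'⟩ := exists_eq_ciSup_of_finite (f := fun G' : G.Subgraph =>
      (G'.edgeSet.ncard : ℝ) / (G'.verts.ncard : ℝ))
  rw [graphDensity, ← hG']
  rcases Set.eq_empty_or_nonempty G'.verts with h0 | h0
  · simp [h0]
  obtain ⟨m, hm, hmax⟩ := G'.verts.toFinite.exists_maximal h0
  have hsub : G'.edgeSet ⊆ (fun u => s(u, if h : ∃ w, u < w ∧ G.Adj u w then h.choose else u)) ''
      (G'.verts \ {m}) := by
    have key : ∀ u v, u < v → G'.Adj u v → u ∈ G'.verts \ {m} ∧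
        (if h : ∃ w, u < w ∧ G.Adj u w then h.choose else u) = v := by
      intro u v huv ha
      refine ⟨⟨ha.fst_mem, ?_⟩, ?_⟩
      · rintro rfl
        exact absurd (hmax ha.snd_mem huv.le) huv.not_ge
      · have hex : ∃ w, u < w ∧ G.Adj u w := ⟨v, huv, ha.adj_sub⟩
        rw [dif_pos hex]
        by_contra hne
        exact h ⟨u, _, v, hne, hex.choose_spec.1, huv, hex.choose_spec.2, ha.adj_sub⟩
    intro e
    induction e using Sym2.ind with
    | _ u v =>
      intro he
      rw [SimpleGraph.Subgraph.mem_edgeSet] at he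
      rcases lt_or_gt_of_ne he.ne with huv | huv
      · exact ⟨u, (key u v huv he).1, by simp only [(key u v huv he).2]⟩
      · refine ⟨v, (key v u huv he.symm).1, ?_⟩
        simp only [(key v u huv he.symm).2]
        exact Sym2.eq_swap
  have hlt : G'.edgeSet.ncard < G'.verts.ncard :=
    ((Set.ncard_le_ncard hsub).trans Set.ncard_image_le).trans_lt
      (Set.ncard_sdiff_singleton_lt_of_mem hm)
  rw [div_lt_one (by exact_mod_cast (Nat.zero_le _).trans_lt hlt)]
  exact_mod_cast hlt

/-! ### Connected ordered graphs -/

theorem SimpleGraph.Connected.mem_of_closed {V : Type*} {G : SimpleGraph V} (hG : G.Connected)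
    {S : Set V} {a : V} (ha : a ∈ S) (hS : ∀ u v, u ∈ S → G.Adj u v → v ∈ S) (v : V) : v ∈ S := by
  obtain ⟨p⟩ := hG.preconnected a v
  induction p with
  | nil => exact ha
  | cons h p ih => exact ih (hS _ _ ha h)

theorem exists_lt_adj {V : Type*} [LinearOrder V] {G : SimpleGraph V} (hG : G.edgeSet.Nonempty) :
    ∃ a b, a < b ∧ G.Adj a b := by
  obtain ⟨e, he⟩ := hG
  induction e using Sym2.ind with
  | _ u v =>
    rw [SimpleGraph.mem_edgeSet] at he
    rcases lt_or_gt_of_ne he.ne with h | h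
    · exact ⟨u, v, h, he⟩
    · exact ⟨v, u, h, he.symm⟩

/-- A connected ordered graph with at least two edges has two edges at a common vertex, which is
one of three ordered paths. -/
theorem cherry_or_monotonePath {V : Type*} [LinearOrder V] {G : SimpleGraph V} (hG : G.Connected)
    (he : G.edgeSet.Nonempty) (hK : ¬ IsOrderedK2 G) :
    HasLeftCherry G ∨ HasRightCherry G ∨ HasMonotonePath G := by
  by_contra! hno
  obtain ⟨hL, hR, hM⟩ := hno
  obtain ⟨a, b, hab, h⟩ := exists_lt_adj he
  apply hK
  have hall : ∀ v, v ∈ ({a, b} : Set V) := by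
    refine hG.mem_of_closed (a := a) (by simp) ?_
    rintro u v hu huv
    by_contra hv
    simp only [Set.mem_insert_iff, Set.mem_singleton_iff, not_or] at hv
    rcases hu with rfl | rfl
    · rcases lt_or_gt_of_ne huv.ne with h' | h'
      · exact hR ⟨u, b, v, Ne.symm hv.2, hab, h', h, huv⟩
      · exact hM ⟨v, u, b, h', hab, huv.symm, h⟩
    · rcases lt_or_gt_of_ne huv.ne with h' | h'
      · exact hM ⟨a, u, v, hab, h', h, huv⟩
      · exact hL ⟨a, v, u, Ne.symm hv.1, hab, h', h, huv.symm⟩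
  have hmono : StrictMono ![a, b] := by
    intro i j hij
    fin_cases i <;> fin_cases j <;> simp_all
  have hsurj : Function.Surjective ![a, b] := by
    intro v
    rcases hall v with rfl | rfl
    · exact ⟨0, rfl⟩
    · exact ⟨1, rfl⟩
  let e := StrictMono.orderIsoOfSurjective _ hmono hsurj
  refine ⟨e.symm, fun u v => ?_⟩
  obtain ⟨i, rfl⟩ := e.surjective u
  obtain ⟨j, rfl⟩ := e.surjective v
  rw [OrderIso.symm_apply_apply, OrderIso.symm_apply_apply]
  change G.Adj (![a, b] i) (![a, b] j) ↔ _
  fin_cases i <;> fin_cases j <;> simp [h, h.symm]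

/-- The only connected ordered graph without cherries that has a monotone `P_3` but no monotone
`P_4` is the monotone `P_3`. -/
theorem isMonotoneP3_of_no_cherry {V : Type*} [LinearOrder V] {G : SimpleGraph V}
    (hG : G.Connected) (hL : ¬ HasLeftCherry G) (hR : ¬ HasRightCherry G) (hM : HasMonotonePath G)
    (hP : ¬ ∃ a b c d, a < b ∧ b < c ∧ c < d ∧ G.Adj a b ∧ G.Adj b c ∧ G.Adj c d) :
    IsMonotoneP3 G := by
  obtain ⟨a, b, c, hab, hbc, h1, h2⟩ := hM
  have hac : ¬ G.Adj a c := fun h => hR ⟨a, b, c, hbc.ne, hab, hab.trans hbc, h1, h⟩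
  have hall : ∀ v, v ∈ ({a, b, c} : Set V) := by
    refine hG.mem_of_closed (a := a) (by simp) ?_
    rintro u v hu huv
    by_contra hv
    simp only [Set.mem_insert_iff, Set.mem_singleton_iff, not_or] at hv
    obtain ⟨va, vb, vc⟩ := hv
    rcases hu with rfl | rfl | rfl <;> rcases lt_or_gt_of_ne huv.ne with h' | h'
    · exact hR ⟨u, b, v, Ne.symm vb, hab, h', h1, huv⟩
    · exact hP ⟨v, u, b, c, h', hab, hbc, huv.symm, h1, h2⟩
    · exact hR ⟨u, c, v, Ne.symm vc, hbc, h', h2, huv⟩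
    · exact hL ⟨a, v, u, Ne.symm va, hab, h', h1, huv.symm⟩
    · exact hP ⟨a, b, u, v, hab, hbc, h', h1, h2, huv⟩
    · exact hL ⟨b, v, u, Ne.symm vb, hbc, h', h2, huv.symm⟩
  have hmono : StrictMono ![a, b, c] := by
    have := hab.trans hbc
    intro i j hij
    fin_cases i <;> fin_cases j <;> simp_all
  have hsurj : Function.Surjective ![a, b, c] := by
    intro v
    rcases hall v with rfl | rfl | rfl
    · exact ⟨0, rfl⟩
    · exact ⟨1, rfl⟩
    · exact ⟨2, rfl⟩
  let e := StrictMono.orderIsoOfSurjective _ hmono hsurj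
  refine ⟨e.symm, fun u v => ?_⟩
  obtain ⟨i, rfl⟩ := e.surjective u
  obtain ⟨j, rfl⟩ := e.surjective v
  rw [OrderIso.symm_apply_apply, OrderIso.symm_apply_apply]
  change G.Adj (![a, b, c] i) (![a, b, c] j) ↔ _
  rw [SimpleGraph.pathGraph_adj]
  fin_cases i <;> fin_cases j <;> simp [h1, h1.symm, h2, h2.symm, hac, mt SimpleGraph.Adj.symm hac]

theorem IsMonotoneP3.hasMonotonePath {V : Type*} [LinearOrder V] {G : SimpleGraph V}
    (hG : IsMonotoneP3 G) : HasMonotonePath G := by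
  obtain ⟨e, he⟩ := hG
  refine ⟨e.symm 0, e.symm 1, e.symm 2, e.symm.strictMono (by decide),
    e.symm.strictMono (by decide), ?_, ?_⟩ <;>
  · rw [he, OrderIso.apply_symm_apply, OrderIso.apply_symm_apply, SimpleGraph.pathGraph_adj]
    decide

theorem IsMonotoneP3.orderedContained {V W : Type*} [LinearOrder V] [LinearOrder W]
    {G : SimpleGraph V} {F : SimpleGraph W} (hG : IsMonotoneP3 G) (hF : HasMonotonePath F) :
    OrderedContained G F := by
  obtain ⟨e, he⟩ := hG
  obtain ⟨a, b, c, hab, hbc, h1, h2⟩ := hF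
  have hmono : StrictMono ![a, b, c] := by
    have := hab.trans hbc
    intro i j hij
    fin_cases i <;> fin_cases j <;> simp_all
  refine ⟨e.toOrderEmbedding.trans (OrderEmbedding.ofStrictMono _ hmono), fun u v huv => ?_⟩
  rw [he, SimpleGraph.pathGraph_adj] at huv
  change F.Adj (![a, b, c] (e u)) (![a, b, c] (e v))
  generalize e u = i at *
  generalize e v = j at *
  fin_cases i <;> fin_cases j <;> simp_all [h1.symm, h2.symm]

theorem IsOrderedK2.orderedContained {V W : Type*} [LinearOrder V] [LinearOrder W]
    {G : SimpleGraph V} {F : SimpleGraph W} (hG : IsOrderedK2 G) {u v : W} (huv : F.Adj u v) :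
    OrderedContained G F := by
  wlog hlt : u < v generalizing u v
  · exact this huv.symm (lt_of_le_of_ne (not_lt.1 hlt) huv.ne')
  obtain ⟨e, he⟩ := hG
  have hmono : StrictMono ![u, v] := by
    intro i j hij
    fin_cases i <;> fin_cases j <;> simp_all
  refine ⟨e.toOrderEmbedding.trans (OrderEmbedding.ofStrictMono _ hmono), fun x y hxy => ?_⟩
  rw [he, SimpleGraph.top_adj] at hxy
  change F.Adj (![u, v] (e x)) (![u, v] (e y))
  generalize e x = i at *
  generalize e y = j at *
  fin_cases i <;> fin_cases j <;> simp_all [huv.symm]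

/-! ### Ramsey graphs -/

/-- The colour of an edge with ends `a < b` may be prescribed by a relation `c a b`. -/
theorem OrderedArrows.exists_copy {U V W : Type*} [LinearOrder U] [LinearOrder V] [LinearOrder W]
    {F : SimpleGraph U} {H : SimpleGraph V} {H' : SimpleGraph W} (h : OrderedArrows F H H')
    (c : U → U → Prop) :
    (∃ g : V ↪o U, ∀ u v, u < v → H.Adj u v → F.Adj (g u) (g v) ∧ c (g u) (g v)) ∨
      (∃ g : W ↪o U, ∀ u v, u < v → H'.Adj u v → F.Adj (g u) (g v) ∧ ¬ c (g u) (g v)) := by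
  classical
  refine (h fun e => decide (c e.1.inf e.1.sup)).imp ?_ ?_
  all_goals
    rintro ⟨g, hg⟩
    refine ⟨g, fun u v huv ha => ?_⟩
    obtain ⟨h1, h2⟩ := (SimpleGraph.EdgeLabeling.labelGraph_adj _ _).1 (hg u v ha)
    have hle : g u ≤ g v := (g.lt_iff_lt.2 huv).le
    simp only [Sym2.inf_mk, Sym2.sup_mk, inf_eq_left.2 hle, sup_eq_right.2 hle] at h2
    exact ⟨h1, by simpa using h2⟩

theorem OrderedArrows.symm {U V W : Type*} [LinearOrder U] [LinearOrder V] [LinearOrder W]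
    {F : SimpleGraph U} {H : SimpleGraph V} {H' : SimpleGraph W} (h : OrderedArrows F H H') :
    OrderedArrows F H' H := by
  intro c
  let c' : F.EdgeLabeling Bool := fun e => !c e
  have key : ∀ b, c'.labelGraph b = c.labelGraph (!b) := by
    intro b
    ext u v
    rw [SimpleGraph.EdgeLabeling.labelGraph_adj, SimpleGraph.EdgeLabeling.labelGraph_adj]
    simp [c', Bool.not_eq_eq_eq_not]
  have := h c'
  rw [key, key] at this
  exact this.symm

/-- The mirror image of `G`. -/
def reverseGraph {V : Type*} (G : SimpleGraph V) : SimpleGraph Vᵒᵈ :=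
  G.comap OrderDual.ofDual

/-- Ramsey graphs are preserved under order isomorphism. -/
theorem OrderedArrows.comap {U U' V W : Type*} [LinearOrder U] [LinearOrder U'] [LinearOrder V]
    [LinearOrder W] {F : SimpleGraph U} {H : SimpleGraph V} {H' : SimpleGraph W}
    (h : OrderedArrows F H H') (e : U' ≃o U) : OrderedArrows (F.comap e) H H' := by
  intro c
  refine (h fun x => c ⟨x.1.map e.symm, ?_⟩).imp ?_ ?_
  · obtain ⟨x, hx⟩ := x
    induction x using Sym2.ind with
    | _ u v => simpa using hx
  all_goals
    rintro ⟨g, hg⟩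
    refine ⟨g.trans e.symm.toOrderEmbedding, fun u v huv => ?_⟩
    obtain ⟨h1, h2⟩ := (SimpleGraph.EdgeLabeling.labelGraph_adj _ _).1 (hg u v huv)
    exact (SimpleGraph.EdgeLabeling.labelGraph_adj _ _).2 ⟨by simpa using h1, h2⟩

theorem OrderedArrows.reverse {U V W : Type*} [LinearOrder U] [LinearOrder V] [LinearOrder W]
    {F : SimpleGraph U} {H : SimpleGraph V} {H' : SimpleGraph W} (h : OrderedArrows F H H') :
    OrderedArrows (reverseGraph F) (reverseGraph H) (reverseGraph H') := by
  intro c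
  refine (h fun x => c ⟨x.1.map OrderDual.toDual, ?_⟩).imp ?_ ?_
  · obtain ⟨x, hx⟩ := x
    induction x using Sym2.ind with
    | _ u v => exact hx
  all_goals
    rintro ⟨g, hg⟩
    refine ⟨g.dual, fun u v huv => ?_⟩
    obtain ⟨h1, h2⟩ := (SimpleGraph.EdgeLabeling.labelGraph_adj _ _).1 (hg _ _ huv)
    exact (SimpleGraph.EdgeLabeling.labelGraph_adj _ _).2 ⟨h1, h2⟩

theorem hasLeftCherry_reverseGraph {V : Type*} [LinearOrder V] {G : SimpleGraph V} :
    HasLeftCherry (reverseGraph G) ↔ HasRightCherry G :=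
  ⟨fun ⟨a, b, c, h, h1, h2, h3, h4⟩ => ⟨OrderDual.ofDual c, OrderDual.ofDual a, OrderDual.ofDual b,
      h, h1, h2, h3.symm, h4.symm⟩,
    fun ⟨c, a, b, h, h1, h2, h3, h4⟩ => ⟨OrderDual.toDual a, OrderDual.toDual b, OrderDual.toDual c,
      h, h1, h2, h3.symm, h4.symm⟩⟩

theorem hasRightCherry_reverseGraph {V : Type*} [LinearOrder V] {G : SimpleGraph V} :
    HasRightCherry (reverseGraph G) ↔ HasLeftCherry G :=
  (hasLeftCherry_reverseGraph (G := reverseGraph G)).symm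

theorem connected_reverseGraph {V : Type*} {G : SimpleGraph V} (hG : G.Connected) :
    (reverseGraph G).Connected :=
  hG

/-! ### Colourings of pseudoforests -/

section Colourings

variable {U V W : Type*} [LinearOrder U] [LinearOrder V] [LinearOrder W]
  {F : SimpleGraph U} {H : SimpleGraph V} {H' : SimpleGraph W}

/-- Give an edge `{v, f v}` of a pseudoforest one of two colours according to its direction. Then
one colour has no right cherry and the other one no left cherry. -/
theorem OrderedArrows.not_hasRightCherry_and_hasLeftCherry (h : OrderedArrows F H H') {f : U → U}
    (hf : ∀ u v, F.Adj u v → f u = v ∨ f v = u) : ¬ (HasRightCherry H ∧ HasLeftCherry H') := by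
  rintro ⟨⟨a, b, c, hbc, hab, hac, h1, h2⟩, ⟨a', b', c', hab', hac', hbc', h1', h2'⟩⟩
  rcases h.exists_copy fun u v => f u = v with ⟨g, hg⟩ | ⟨g, hg⟩
  · exact hbc (g.injective ((hg a b hab h1).2.symm.trans (hg a c hac h2).2))
  · have k1 := hg a' c' hac' h1'
    have k2 := hg b' c' hbc' h2'
    exact hab' (g.injective (((hf _ _ k1.1).resolve_left k1.2).symm.trans
      ((hf _ _ k2.1).resolve_left k2.2)))

/-- Make the edge from `u` to `f u` red if it turns, that is, if exactly one of `u < f u` and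
`f u < f (f u)` holds. Then no path of two red edges is monotone, and a connected blue graph has
all its edges in the same direction, so it misses one of the two cherries. -/
theorem OrderedArrows.not_hasMonotonePath_and_cherries (h : OrderedArrows F H H') {f : U → U}
    (hf : ∀ u v, F.Adj u v → f u = v ∨ f v = u) (hH' : H'.Connected) :
    ¬ (HasMonotonePath H ∧ HasLeftCherry H' ∧ HasRightCherry H') := by
  rintro ⟨⟨a, b, c, hab, hbc, h1, h2⟩, ⟨a', b', c', n', hac', hbc', h1', h2'⟩,
    ⟨a'', b'', c'', n'', hab'', hac'', h1'', h2''⟩⟩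
  rcases h.exists_copy fun u v => ¬ (u < f u ↔ v < f v) with ⟨g, hg⟩ | ⟨g, hg⟩
  · have k1 := hg a b hab h1
    have k2 := hg b c hbc h2
    have l1 := g.lt_iff_lt.2 hab
    have l2 := g.lt_iff_lt.2 hbc
    by_cases hb : g b < f (g b)
    · have : f (g a) = g b := (hf _ _ k1.1).resolve_right fun e => (e ▸ hb).not_gt l1
      exact k1.2 (iff_of_true (this ▸ l1) hb)
    · have : f (g c) = g b := (hf _ _ k2.1).resolve_left fun e => hb (e ▸ l2)
      exact k2.2 (iff_of_false hb (this ▸ l2.not_gt))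
  · have hstep : ∀ u v, H'.Adj u v → (g u < f (g u) ↔ g v < f (g v)) := by
      intro u v huv
      rcases lt_or_gt_of_ne huv.ne with hlt | hlt
      · exact not_not.1 (hg u v hlt huv).2
      · exact (not_not.1 (hg v u hlt huv.symm).2).symm
    have hall : ∀ v, (g a' < f (g a') ↔ g v < f (g v)) :=
      hH'.mem_of_closed (S := {v | g a' < f (g a') ↔ g v < f (g v)}) (a := a') Iff.rfl
        fun u v hu huv => Iff.trans hu (hstep u v huv)
    by_cases hd : g a' < f (g a')
    · have key : ∀ u v, u < v → H'.Adj u v → f (g u) = g v := fun u v huv ha =>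
        (hf _ _ (hg u v huv ha).1).resolve_right fun e =>
          (e ▸ (hall v).1 hd).not_gt (g.lt_iff_lt.2 huv)
      exact n'' (g.injective ((key _ _ hab'' h1'').symm.trans (key _ _ hac'' h2'')))
    · have key : ∀ u v, u < v → H'.Adj u v → f (g v) = g u := fun u v huv ha =>
        (hf _ _ (hg u v huv ha).1).resolve_left fun e =>
          hd ((hall u).2 (e ▸ (g.lt_iff_lt.2 huv)))
      exact n' (g.injective ((key _ _ hac' h1').symm.trans (key _ _ hbc' h2')))

/-- Every self-map `f` of a finite linear order has a set of elements `u` determined by the rule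
that `u` belongs to it if and only if `u < f u` and `f u` does not. -/
theorem exists_alternating {U : Type*} [LinearOrder U] [Finite U] (f : U → U) :
    ∃ S : U → Prop, ∀ u, S u ↔ u < f u ∧ ¬ S (f u) := by
  let S : U → Prop := (wellFounded_gt (α := U)).fix fun u ih => ∃ h : u < f u, ¬ ih (f u) h
  refine ⟨S, fun u => ?_⟩
  have := (wellFounded_gt (α := U)).fix_eq (fun u ih => ∃ h : u < f u, ¬ ih (f u) h) u
  change S u = _ at this
  rw [this]
  simp [S]

/-- A connected graph without right cherries that has a left cherry and a monotone `P_3` has the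
two in one of two positions: the cherry's apex is the second or the third vertex of the path. -/
theorem exists_leftCherry_on_monotonePath {V : Type*} [LinearOrder V] {G : SimpleGraph V}
    (hG : G.Connected) (hR : ¬ HasRightCherry G) (hL : HasLeftCherry G) (hM : HasMonotonePath G) :
    (∃ a b c d, a ≠ b ∧ a < c ∧ b < c ∧ c < d ∧ G.Adj a c ∧ G.Adj b c ∧ G.Adj c d) ∨
      ∃ a b c d, a < b ∧ b < c ∧ d < c ∧ b ≠ d ∧ G.Adj a b ∧ G.Adj b c ∧ G.Adj d c := by
  by_contra! hno
  obtain ⟨h1, h2⟩ := hno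
  obtain ⟨x, y, z, hxy, hxz, hyz, hxz', hyz'⟩ := hL
  -- otherwise the graph is the star with centre `z` and all other vertices to the left
  have hall : ∀ v, v = z ∨ (v < z ∧ G.Adj v z) := by
    refine hG.mem_of_closed (S := {v | v = z ∨ (v < z ∧ G.Adj v z)}) (a := z) (Or.inl rfl) ?_
    rintro u v (rfl | ⟨hlt, ha⟩) huv
    · rcases lt_or_gt_of_ne huv.ne with h | h
      · exact absurd huv (h1 x y u v hxy hxz hyz h hxz' hyz')
      · exact Or.inr ⟨h, huv.symm⟩
    · rcases lt_or_gt_of_ne huv.ne with h | h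
      · by_contra hv
        exact hR ⟨u, v, z, fun e => hv (Or.inl e), h, hlt, huv, ha⟩
      · exfalso
        obtain ⟨d, hd, hdz, hdz'⟩ : ∃ d, u ≠ d ∧ d < z ∧ G.Adj d z := by
          by_cases hux : u = x
          · exact ⟨y, hux ▸ hxy, hyz, hyz'⟩
          · exact ⟨x, hux, hxz, hxz'⟩
        exact h2 v u z d h hlt hdz hd huv.symm ha hdz'
  obtain ⟨a, b, c, hab, hbc, hab', hbc'⟩ := hM
  rcases hall b with rfl | ⟨hb, hb'⟩
  · exact h1 x y b c hxy hxz hyz hbc hxz' hyz' hbc'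
  · have hcz : c = z := by
      by_contra hne
      exact hR ⟨b, c, z, hne, hbc, hb, hbc', hb'⟩
    rcases hall a with rfl | ⟨ha, ha'⟩
    · exact absurd hb hab.not_gt
    · exact hR ⟨a, b, z, hb.ne, hab, ha, hab', ha'⟩

/-- Colour an edge red if its left end is in the alternating set of `f`. Then no path of two red
edges is monotone, and no blue left cherry is as in `exists_leftCherry_on_monotonePath`. -/
theorem OrderedArrows.not_hasLeftCherry [Finite U] (h : OrderedArrows F H H') {f : U → U}
    (hf : ∀ u v, F.Adj u v → f u = v ∨ f v = u) (hM : HasMonotonePath H) (hH' : H'.Connected)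
    (hR' : ¬ HasRightCherry H') (hM' : HasMonotonePath H') : ¬ HasLeftCherry H' := by
  intro hL'
  obtain ⟨S, hS⟩ := exists_alternating f
  -- neighbours of an element of `S` to its left, and their colours
  have down : ∀ u v, u < v → f v = u → ¬ S v := fun u v huv e hv =>
    ((hS v).1 hv).1.not_gt (e.symm ▸ huv)
  have up : ∀ u v, u < v → f u = v → (S u ↔ ¬ S v) := fun u v huv e => by
    rw [hS u, e]
    exact and_iff_right huv
  rcases h.exists_copy fun u _ => S u with ⟨g, hg⟩ | ⟨g, hg⟩
  · obtain ⟨a, b, c, hab, hbc, h1, h2⟩ := hM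
    have k1 := hg a b hab h1
    have k2 := hg b c hbc h2
    have l1 := g.lt_iff_lt.2 hab
    rcases hf _ _ k1.1 with e | e
    · exact (up _ _ l1 e).1 k1.2 k2.2
    · exact down _ _ l1 e k2.2
  · rcases exists_leftCherry_on_monotonePath hH' hR' hL' hM' with
      ⟨a, b, c, d, hne, hac, hbc, hcd, h1, h2, h3⟩ | ⟨a, b, c, d, hab, hbc, hdc, hne, h1, h2, h3⟩
    · have hc := (hg c d hcd h3).2
      -- both edges of the cherry lead from `g c` to the left
      have key : ∀ x, x < c → H'.Adj x c → f (g c) = g x := fun x hx hxc =>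
        (hf _ _ (hg x c hx hxc).1).resolve_left fun e =>
          (hg x c hx hxc).2 ((up _ _ (g.lt_iff_lt.2 hx) e).2 hc)
      exact hne (g.injective ((key a hac h1).symm.trans (key b hbc h2)))
    · have ka := hg a b hab h1
      have kb := hg b c hbc h2
      have kd := hg d c hdc h3
      have lb := g.lt_iff_lt.2 hbc
      have ld := g.lt_iff_lt.2 hdc
      have la := g.lt_iff_lt.2 hab
      have hba : f (g b) = g a := (hf _ _ ka.1).resolve_left fun e =>
        ka.2 ((up _ _ la e).2 kb.2)
      have hcb : f (g c) = g b := (hf _ _ kb.1).resolve_left fun e =>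
        (la.trans lb).ne (hba.symm.trans e)
      have hdc' : f (g d) = g c := (hf _ _ kd.1).resolve_right fun e =>
        hne (g.injective (hcb.symm.trans e))
      exact kd.2 ((up _ _ ld hdc').2 (down _ _ lb hcb))

/-- A choice of one recurrent point `r u` for each component of a functional graph. -/
theorem exists_component_representative {U : Type*} [Finite U] (f : U → U) :
    ∃ r : U → U, (∀ u, r (f u) = r u) ∧ (∀ u, r (r u) = r u) ∧ ∀ u, ∃ n, f^[n] u = r u := by
  classical
  -- the set of points that the orbit of `u` visits infinitely often
  let A : U → Set U := fun u => {v | ∃ᶠ n in Filter.atTop, f^[n] u = v}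
  have hA : ∀ u, (A u).Nonempty := by
    intro u
    by_contra hne
    have : ∀ v, ∀ᶠ n in Filter.atTop, f^[n] u ≠ v := fun v => by
      by_contra hv
      exact hne ⟨v, hv⟩
    obtain ⟨n, hn⟩ := (Filter.eventually_all.2 this).exists
    exact hn _ rfl
  have hAf : ∀ u, A (f u) = A u := by
    intro u
    ext v
    change (∃ᶠ n in Filter.atTop, f^[n + 1] u = v) ↔ ∃ᶠ n in Filter.atTop, f^[n] u = v
    conv_rhs => rw [← Filter.map_add_atTop_eq_nat 1, Filter.frequently_map]
  let r : U → U := fun u => (hA u).some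
  have hr : ∀ u v, A u = A v → r u = r v := by
    intro u v huv
    simp only [r]
    congr
  have hrn : ∀ u, ∃ n, f^[n] u = r u := fun u => (hA u).some_mem.exists
  have hAn : ∀ n u, A (f^[n] u) = A u := by
    intro n
    induction n with
    | zero => exact fun u => rfl
    | succ n ih => exact fun u => (ih (f u)).trans (hAf u)
  refine ⟨r, fun u => hr _ _ (hAf u), fun u => ?_, hrn⟩
  obtain ⟨n, hn⟩ := hrn u
  exact hr _ _ (hn ▸ hAn n u)

/-- Colour the vertices by the parity of their distance along `f` to the representative of their
component. This is proper except perhaps at the edge that leaves the representative, where both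
ends have the colour `false`. Give every edge the colour of its left end. -/
theorem OrderedArrows.not_exists_monotoneP4 [Finite U] (h : OrderedArrows F H H') {f : U → U}
    (hf : ∀ u v, F.Adj u v → f u = v ∨ f v = u) (hM : HasMonotonePath H) :
    ¬ ∃ a b c d, a < b ∧ b < c ∧ c < d ∧ H'.Adj a b ∧ H'.Adj b c ∧ H'.Adj c d := by
  classical
  rintro ⟨a', b', c', d', lab, lbc, lcd, h1', h2', h3'⟩
  obtain ⟨r, hrf, hrr, hrn⟩ := exists_component_representative f
  let d : U → ℕ := fun u => Nat.find (hrn u)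
  have hd0 : ∀ u, r u = u → d u = 0 := fun u hu => (Nat.find_eq_zero _).2 hu.symm
  have hdS : ∀ u, r u ≠ u → d u = d (f u) + 1 := by
    intro u hu
    have h0 : ¬ f^[0] u = r u := fun e => hu e.symm
    simp only [d]
    rw [Nat.find_comp_succ (hrn u) ⟨_, (Nat.find_spec (hrn (f u))).trans (hrf u)⟩ h0]
    congr 2
    ext n
    rw [hrf]
    rfl
  let ρ : U → Prop := fun u => Odd (d u)
  have hρ : ∀ u, (ρ u ↔ ¬ ρ (f u)) ∨ (¬ ρ u ∧ r u = u) := by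
    intro u
    by_cases hu : r u = u
    · exact Or.inr ⟨by simp [ρ, hd0 u hu], hu⟩
    · left
      simp only [ρ, hdS u hu, Nat.odd_add_one]
  -- an edge with ends of the same colour leaves the representative of its component
  have bad : ∀ u v, F.Adj u v → (ρ u ↔ ρ v) →
      ¬ (ρ u ∧ ρ v) ∧ ((r u = u ∧ f u = v) ∨ (r v = v ∧ f v = u)) := by
    intro u v huv hiff
    rcases hf u v huv with e | e
    · rcases hρ u with h' | h'
      · rw [e] at h'
        exact absurd (h'.symm.trans hiff) (by tauto)
      · exact ⟨fun k => h'.1 k.1, Or.inl ⟨h'.2, e⟩⟩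
    · rcases hρ v with h' | h'
      · rw [e] at h'
        exact absurd (h'.symm.trans hiff.symm) (by tauto)
      · exact ⟨fun k => h'.1 k.2, Or.inr ⟨h'.2, e⟩⟩
  rcases h.exists_copy fun u _ => ρ u with ⟨g, hg⟩ | ⟨g, hg⟩
  · obtain ⟨a, b, c, hab, hbc, h1, h2⟩ := hM
    have k1 := hg a b hab h1
    have k2 := hg b c hbc h2
    exact (bad _ _ k1.1 (iff_of_true k1.2 k2.2)).1 ⟨k1.2, k2.2⟩
  · have k1 := hg a' b' lab h1'
    have k2 := hg b' c' lbc h2'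
    have k3 := hg c' d' lcd h3'
    have b1 := (bad _ _ k1.1 (iff_of_false k1.2 k2.2)).2
    have b2 := (bad _ _ k2.1 (iff_of_false k2.2 k3.2)).2
    have l1 := g.lt_iff_lt.2 lab
    have l2 := g.lt_iff_lt.2 lbc
    have r1 : r (g a') = r (g b') := by
      rcases b1 with ⟨_, e⟩ | ⟨_, e⟩
      · rw [← e, hrf]
      · rw [← e, hrf]
    have r2 : r (g b') = r (g c') := by
      rcases b2 with ⟨_, e⟩ | ⟨_, e⟩
      · rw [← e, hrf]
      · rw [← e, hrf]
    rcases b1 with ⟨e1, f1⟩ | ⟨e1, f1⟩ <;> rcases b2 with ⟨e2, f2⟩ | ⟨e2, f2⟩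
    · exact l1.ne (e1.symm.trans (r1.trans e2))
    · exact (l1.trans l2).ne (e1.symm.trans (r1.trans (r2.trans e2)))
    · exact (l1.trans l2).ne (f1.symm.trans f2)
    · exact l2.ne (e1.symm.trans (r2.trans e2))

end Colourings

/-! ### Forests that are Ramsey graphs for a star -/

/-- A connected graph without right cherries and monotone paths is a star with centre to the right
of all other vertices. -/
theorem exists_right_centre {V : Type*} [LinearOrder V] {G : SimpleGraph V} (hG : G.Connected)
    (he : G.edgeSet.Nonempty) (hR : ¬ HasRightCherry G) (hM : ¬ HasMonotonePath G) :
    ∃ z, (∀ v, v ≤ z) ∧ ∀ u v, u < v → G.Adj u v → v = z := by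
  obtain ⟨a, z, haz, h⟩ := exists_lt_adj he
  have hall : ∀ v, v = z ∨ (v < z ∧ G.Adj v z) := by
    refine hG.mem_of_closed (S := {v | v = z ∨ (v < z ∧ G.Adj v z)}) (a := z) (Or.inl rfl) ?_
    rintro u v (rfl | ⟨hlt, ha⟩) huv
    · rcases lt_or_gt_of_ne huv.ne with h' | h'
      · exact absurd ⟨a, u, v, haz, h', h, huv⟩ hM
      · exact Or.inr ⟨h', huv.symm⟩
    · rcases lt_or_gt_of_ne huv.ne with h' | h'
      · by_contra hv
        exact hR ⟨u, v, z, fun e => hv (Or.inl e), h', hlt, huv, ha⟩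
      · exact absurd ⟨v, u, z, h', hlt, huv.symm, ha⟩ hM
  refine ⟨z, fun v => (hall v).elim le_of_eq fun k => k.1.le, fun u v huv ha => ?_⟩
  rcases hall v with rfl | ⟨k, k'⟩
  · rfl
  · exact absurd ⟨u, v, z, huv, k, ha, k'⟩ hM

theorem orderedContained_of_right_centre {U V : Type*} [LinearOrder U] [LinearOrder V] [Finite V]
    {G : SimpleGraph V} {F : SimpleGraph U} {z : V} (hz : ∀ v, v ≤ z)
    (hG : ∀ u v, u < v → G.Adj u v → v = z) {x : U} {s : Finset U}
    (hs : ∀ y ∈ s, y < x ∧ F.Adj y x) (hcard : Nat.card V ≤ s.card + 1) :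
    OrderedContained G F := by
  classical
  have := Fintype.ofFinite V
  obtain ⟨t, hts, htc⟩ := Finset.exists_subset_card_eq (n := Nat.card V - 1) (s := s) (by omega)
  have hpos : 0 < Nat.card V := Nat.card_pos_iff.2 ⟨⟨z⟩, inferInstance⟩
  have hx : x ∉ t := fun h => (hs x (hts h)).1.ne rfl
  have hc : (insert x t).card = Fintype.card V := by
    rw [Finset.card_insert_of_notMem hx, htc, ← Nat.card_eq_fintype_card]
    omega
  let e := (monoEquivOfFin V rfl).symm.trans ((insert x t).orderIsoOfFin hc)
  have hle : ∀ v, (e v : U) ≤ x := fun v => by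
    rcases Finset.mem_insert.1 (e v).2 with h | h
    · exact h.le
    · exact (hs _ (hts h)).1.le
  have hez : (e z : U) = x := by
    refine le_antisymm (hle z) ?_
    have : e (e.symm ⟨x, Finset.mem_insert_self _ _⟩) ≤ e z := e.monotone (hz _)
    rw [OrderIso.apply_symm_apply] at this
    exact this
  have key : ∀ u v, u < v → G.Adj u v → F.Adj (e u) (e v) := by
    intro u v huv ha
    obtain rfl := hG u v huv ha
    rw [hez]
    have hlt : (e u : U) < e v := e.lt_iff_lt.2 huv
    rw [hez] at hlt
    exact (hs _ (hts ((Finset.mem_insert.1 (e u).2).resolve_left hlt.ne))).2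
  refine ⟨e.toOrderEmbedding.trans (OrderEmbedding.subtype _), fun u v ha => ?_⟩
  rcases lt_or_gt_of_ne ha.ne with h | h
  · exact key u v h ha
  · exact (key v u h ha.symm).symm

/-- The blow-up of a graph on `W`: a vertex `i` is replaced by consecutive copies, which are
labelled by functions `w : W → Fin (m + 1)`. If `j` is a neighbour of `i` to its right, then the
copy `w` of `i` is joined to that copy of `j` whose label is obtained from `w` by setting `w i`
to `0`. So a copy of `j` whose label vanishes at `i` is joined to `m + 1` copies of `i`. -/
def blowUp {W : Type*} [LinearOrder W] (G : SimpleGraph W) (m : ℕ) :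
    SimpleGraph (W ×ₗ (Πₗ _ : W, Fin (m + 1))) :=
  SimpleGraph.fromRel fun x y => (ofLex x).1 < (ofLex y).1 ∧ G.Adj (ofLex x).1 (ofLex y).1 ∧
    ofLex (ofLex y).2 = Function.update (ofLex (ofLex x).2) (ofLex x).1 0

theorem not_hasRightCherry_blowUp {W : Type*} [LinearOrder W] [Finite W] {G : SimpleGraph W}
    (hG : ¬ HasRightCherry G) (m : ℕ) : ¬ HasRightCherry (blowUp G m) := by
  have key : ∀ x y, x < y → (blowUp G m).Adj x y → (ofLex x).1 < (ofLex y).1 ∧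
      G.Adj (ofLex x).1 (ofLex y).1 ∧
      ofLex (ofLex y).2 = Function.update (ofLex (ofLex x).2) (ofLex x).1 0 := by
    rintro x y hxy ⟨-, h | h⟩
    · exact h
    · exact absurd h.1 (Prod.Lex.monotone_fst _ _ hxy.le).not_gt
  rintro ⟨x, y, z, hyz, hxy, hxz, h1, h2⟩
  obtain ⟨l1, a1, e1⟩ := key x y hxy h1
  obtain ⟨l2, a2, e2⟩ := key x z hxz h2
  apply hyz
  have hfst : (ofLex y).1 = (ofLex z).1 := by
    by_contra hne
    exact hG ⟨_, _, _, hne, l1, l2, a1, a2⟩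
  exact congrArg toLex (Prod.ext hfst (e1.trans e2.symm))

/-- Functions on a finite linear order may be defined recursively from right to left. -/
theorem exists_recursive_function {W C : Type*} [LinearOrder W] [Finite W]
    (Φ : (i : W) → (W → C) → C)
    (hΦ : ∀ i w w', (∀ j, i < j → w j = w' j) → Φ i w = Φ i w') [Nonempty C] :
    ∃ w : W → C, ∀ i, w i = Φ i w := by
  classical
  let w : W → C := (wellFounded_gt (α := W)).fix fun i ih =>
    Φ i fun j => if h : i < j then ih j h else Classical.arbitrary C
  refine ⟨w, fun i => ?_⟩
  have := (wellFounded_gt (α := W)).fix_eq (fun i ih =>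
    Φ i fun j => if h : i < j then ih j h else Classical.arbitrary C) i
  change w i = _ at this
  rw [this]
  refine hΦ i _ _ fun j hj => ?_
  rw [dif_pos hj]

/-- If `H` is a star with centre to the right, then a blow-up of a forest `H'` with at most one edge
to the right of each vertex is a Ramsey graph: without a red copy of `H`, a blue copy of `H'` is
found from right to left. -/
theorem orderedArrows_blowUp {V W : Type*} [LinearOrder V] [Finite V] [LinearOrder W] [Finite W]
    {H : SimpleGraph V} {H' : SimpleGraph W} {z : V} (hz : ∀ v, v ≤ z)
    (hH : ∀ u v, u < v → H.Adj u v → v = z) (hR' : ¬ HasRightCherry H')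
    {m : ℕ} (hm : Nat.card V ≤ m) : OrderedArrows (blowUp H' m) H H' := by
  classical
  intro c
  by_contra! hno
  obtain ⟨hred, hblue⟩ := hno
  -- at least one of the `m + 1` copies of `i` below a copy of `j` is joined to it in blue
  have hstep : ∀ i j, ∀ w : W → Fin (m + 1), i < j → H'.Adj i j → w i = 0 → ∃ a,
      (c.labelGraph false).Adj (toLex (i, toLex (Function.update w i a))) (toLex (j, toLex w)) := by
    intro i j w hij ha hw
    by_contra! hall
    apply hred
    let φ : Fin (m + 1) → W ×ₗ (Πₗ _ : W, Fin (m + 1)) :=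
      fun a => toLex (i, toLex (Function.update w i a))
    have hφ : Function.Injective φ := by
      intro a b hab
      have : Function.update w i a = Function.update w i b :=
        congrArg (fun x => ofLex (ofLex x).2) hab
      simpa using congrFun this i
    refine orderedContained_of_right_centre hz hH (x := toLex (j, toLex w))
      (s := Finset.univ.image φ) ?_ ?_
    · intro y hy
      obtain ⟨a, -, rfl⟩ := Finset.mem_image.1 hy
      have hlt : φ a < toLex (j, toLex w) := Prod.Lex.toLex_lt_toLex.2 (Or.inl hij)
      have hadj : (blowUp H' m).Adj (φ a) (toLex (j, toLex w)) := by
        refine ⟨hlt.ne, Or.inl ⟨hij, ha, ?_⟩⟩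
        change w = Function.update (Function.update w i a) i 0
        rw [Function.update_idem, ← hw, Function.update_eq_self]
      refine ⟨hlt, (SimpleGraph.EdgeLabeling.labelGraph_adj _ _).2 ⟨hadj, ?_⟩⟩
      by_contra hcol
      exact hall a ((SimpleGraph.EdgeLabeling.labelGraph_adj _ _).2
        ⟨hadj, Bool.eq_false_of_not_eq_true hcol⟩)
    · rw [Finset.card_image_of_injective _ hφ, Finset.card_univ, Fintype.card_fin]
      omega
  choose! A hA using hstep
  obtain ⟨w, hw⟩ := exists_recursive_function (W := W) (C := W → Fin (m + 1))
    (fun i w => if h : ∃ j, i < j ∧ H'.Adj i j then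
      Function.update (w h.choose) i (A i h.choose (w h.choose)) else 0) (by
        intro i w w' hww
        by_cases h : ∃ j, i < j ∧ H'.Adj i j
        · simp only [dif_pos h, hww _ h.choose_spec.1]
        · simp only [dif_neg h])
  have hzero : ∀ j i, i < j → w j i = 0 := by
    intro j
    induction j using (wellFounded_gt (α := W)).induction with
    | _ j ih =>
      intro i hij
      rw [hw]
      by_cases h : ∃ k, j < k ∧ H'.Adj j k
      · rw [dif_pos h, Function.update_of_ne hij.ne]
        exact ih _ h.choose_spec.1 i (hij.trans h.choose_spec.1)
      · rw [dif_neg h]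
        rfl
  have hadj : ∀ i j, i < j → H'.Adj i j →
      (c.labelGraph false).Adj (toLex (i, toLex (w i))) (toLex (j, toLex (w j))) := by
    intro i j hij ha
    have h : ∃ j, i < j ∧ H'.Adj i j := ⟨j, hij, ha⟩
    have hj : h.choose = j := by
      by_contra hne
      exact hR' ⟨i, _, j, hne, h.choose_spec.1, hij, h.choose_spec.2, ha⟩
    have hwi := hw i
    rw [dif_pos h, hj] at hwi
    rw [hwi]
    exact hA i j (w j) hij ha (hzero j i hij)
  apply hblue
  refine ⟨OrderEmbedding.ofStrictMono (fun i => toLex (i, toLex (w i))) fun i j hij =>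
    Prod.Lex.toLex_lt_toLex.2 (Or.inl hij), fun u v huv => ?_⟩
  rcases lt_or_gt_of_ne huv.ne with h | h
  · exact hadj u v h huv
  · exact (hadj v u h huv.symm).symm

/-! ### Ramsey density -/

theorem orderedRamseyDensity_le {V W : Type*} [LinearOrder V] [LinearOrder W]
    {H : SimpleGraph V} {H' : SimpleGraph W} {U : Type*} [LinearOrder U] [Finite U]
    {F : SimpleGraph U} (hF : OrderedArrows F H H') :
    orderedRamseyDensity H H' ≤ graphDensity F := by
  have := Fintype.ofFinite U
  let e := monoEquivOfFin U rfl
  have hbdd : BddBelow ((fun F : Σ n : ℕ, SimpleGraph (Fin n) => graphDensity F.2) ''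
      orderedRamseyGraphs H H') := ⟨0, by
    rintro _ ⟨F, -, rfl⟩
    exact graphDensity_nonneg _⟩
  refine (csInf_le hbdd (Set.mem_image_of_mem _ (show (⟨_, F.comap e⟩ : Σ n, SimpleGraph (Fin n)) ∈
    orderedRamseyGraphs H H' from hF.comap e))).trans ?_
  exact OrderedContained.graphDensity_le ⟨e.toOrderEmbedding, fun u v h => h⟩

theorem le_orderedRamseyDensity {V W : Type*} [LinearOrder V] [LinearOrder W]
    {H : SimpleGraph V} {H' : SimpleGraph W} (hne : (orderedRamseyGraphs H H').Nonempty) {r : ℝ}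
    (h : ∀ F ∈ orderedRamseyGraphs H H', r ≤ graphDensity F.2) : r ≤ orderedRamseyDensity H H' := by
  refine le_csInf (hne.image _) ?_
  rintro _ ⟨F, hF, rfl⟩
  exact h F hF

/-- If no forest is a Ramsey graph, then a graph without right cherries has a monotone `P_3`. -/
theorem hasMonotonePath_of_one_le_orderedRamseyDensity {V W : Type*} [LinearOrder V] [Finite V]
    [LinearOrder W] [Finite W] {H : SimpleGraph V} {H' : SimpleGraph W} (hH : H.Connected)
    (heH : H.edgeSet.Nonempty) (hR : ¬ HasRightCherry H) (hR' : ¬ HasRightCherry H')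
    (hd : 1 ≤ orderedRamseyDensity H H') : HasMonotonePath H := by
  by_contra hM
  obtain ⟨z, hz, hz'⟩ := exists_right_centre hH heH hR hM
  have : Finite (W ×ₗ (Πₗ _ : W, Fin (Nat.card V + 1))) :=
    inferInstanceAs (Finite (W × (W → Fin (Nat.card V + 1))))
  exact (hd.trans (orderedRamseyDensity_le (orderedArrows_blowUp hz hz' hR' le_rfl))).not_gt
    (graphDensity_lt_one_of_not_hasRightCherry (not_hasRightCherry_blowUp hR' _))

theorem orderedRamseyDensity_comm {V W : Type*} [LinearOrder V] [LinearOrder W]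
    (H : SimpleGraph V) (H' : SimpleGraph W) :
    orderedRamseyDensity H H' = orderedRamseyDensity H' H := by
  have : orderedRamseyGraphs H H' = orderedRamseyGraphs H' H :=
    Set.ext fun F => ⟨fun h => OrderedArrows.symm h, fun h => OrderedArrows.symm h⟩
  rw [orderedRamseyDensity, orderedRamseyDensity, this]

theorem edgeSet_reverseGraph_nonempty {V : Type*} {G : SimpleGraph V} (hG : G.edgeSet.Nonempty) :
    (reverseGraph G).edgeSet.Nonempty :=
  hG

/-- The mirror image of a Ramsey graph has the same density. -/
theorem orderedRamseyDensity_reverseGraph_le {V W : Type*} [LinearOrder V] [LinearOrder W]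
    {H : SimpleGraph V} {H' : SimpleGraph W} (hne : (orderedRamseyGraphs H H').Nonempty) :
    orderedRamseyDensity (reverseGraph H) (reverseGraph H') ≤ orderedRamseyDensity H H' :=
  le_orderedRamseyDensity hne fun F hF =>
    (orderedRamseyDensity_le (OrderedArrows.reverse hF)).trans (le_refl (graphDensity F.2))

/-! ### Pairs without `K_2` that have a pseudoforest but no forest as a Ramsey graph -/

section

variable {V W : Type*} [LinearOrder V] [LinearOrder W]
  {H : SimpleGraph V} {H' : SimpleGraph W}

/-- If no forest is a Ramsey graph, then neither graph is a star whose centre is its last vertex, so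
both have a monotone `P_3` and the alternating colouring applies to both. -/
theorem not_hasLeftCherry_of_not_hasRightCherry [Finite V] [Finite W] {U : Type*}
    [LinearOrder U] [Finite U] {F : SimpleGraph U} (hH : H.Connected) (hH' : H'.Connected)
    (heH : H.edgeSet.Nonempty) (heH' : H'.edgeSet.Nonempty)
    (h : OrderedArrows F H H') (hF : IsPseudoforest F)
    (hR : ¬ HasRightCherry H) (hR' : ¬ HasRightCherry H') (hd : 1 ≤ orderedRamseyDensity H H') :
    ¬ HasLeftCherry H ∧ ¬ HasLeftCherry H' := by
  obtain ⟨f, hf⟩ := hF.exists_map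
  have hM := hasMonotonePath_of_one_le_orderedRamseyDensity hH heH hR hR' hd
  have hM' := hasMonotonePath_of_one_le_orderedRamseyDensity hH' heH' hR' hR
    (orderedRamseyDensity_comm H H' ▸ hd)
  exact ⟨h.symm.not_hasLeftCherry hf hM' hH hR hM, h.not_hasLeftCherry hf hM hH' hR' hM'⟩

/-- If neither graph is `K_2`, a pseudoforest is a Ramsey graph and no forest is, then both graphs
are monotone paths on three vertices. -/
theorem isMonotoneP3_of_pseudoforest [Finite V] [Finite W] {n : ℕ} {F : SimpleGraph (Fin n)}
    (hH : H.Connected) (hH' : H'.Connected) (heH : H.edgeSet.Nonempty)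
    (heH' : H'.edgeSet.Nonempty) (hK : ¬ IsOrderedK2 H) (hK' : ¬ IsOrderedK2 H')
    (h : OrderedArrows F H H') (hF : IsPseudoforest F) (hd : orderedRamseyDensity H H' = 1) :
    IsMonotoneP3 H ∧ IsMonotoneP3 H' := by
  obtain ⟨f, hf⟩ := hF.exists_map
  have c := cherry_or_monotonePath hH heH hK
  have c' := cherry_or_monotonePath hH' heH' hK'
  have a1 := h.not_hasRightCherry_and_hasLeftCherry hf
  have a2 := h.symm.not_hasRightCherry_and_hasLeftCherry hf
  have b1 := h.not_hasMonotonePath_and_cherries hf hH'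
  have b2 := h.symm.not_hasMonotonePath_and_cherries hf hH
  have hno : (¬ HasLeftCherry H ∧ ¬ HasRightCherry H) ∧
      (¬ HasLeftCherry H' ∧ ¬ HasRightCherry H') := by
    -- a graph with both cherries forces the other one to be a monotone path, against `b1`, `b2`
    have hside : (¬ HasRightCherry H ∧ ¬ HasRightCherry H') ∨
        (¬ HasLeftCherry H ∧ ¬ HasLeftCherry H') := by tauto
    rcases hside with ⟨k, k'⟩ | ⟨k, k'⟩
    · have := not_hasLeftCherry_of_not_hasRightCherry hH hH' heH heH' h hF k k' hd.ge
      exact ⟨⟨this.1, k⟩, this.2, k'⟩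
    · -- the mirror images of `H` and `H'` have no right cherries
      have := not_hasLeftCherry_of_not_hasRightCherry (connected_reverseGraph hH)
        (connected_reverseGraph hH') (edgeSet_reverseGraph_nonempty heH)
        (edgeSet_reverseGraph_nonempty heH') h.reverse hF
        (by rwa [hasRightCherry_reverseGraph]) (by rwa [hasRightCherry_reverseGraph]) ?_
      · rw [hasLeftCherry_reverseGraph, hasLeftCherry_reverseGraph] at this
        exact ⟨⟨k, this.1⟩, k', this.2⟩
      · exact hd.ge.trans (orderedRamseyDensity_reverseGraph_le (H := reverseGraph H)
          (H' := reverseGraph H') ⟨⟨n, _⟩, h.reverse.comap Fin.revOrderIso.symm⟩)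
  obtain ⟨⟨l, r⟩, l', r'⟩ := hno
  have hM : HasMonotonePath H := by tauto
  have hM' : HasMonotonePath H' := by tauto
  exact ⟨isMonotoneP3_of_no_cherry hH l r hM (h.symm.not_exists_monotoneP4 hf hM'),
    isMonotoneP3_of_no_cherry hH' l' r' hM' (h.not_exists_monotoneP4 hf hM)⟩

/-! ### A pair of monotone paths -/

/-- A Ramsey graph for two monotone `P_3` has a cycle: otherwise it has a proper 2-colouring of the
vertices, and each edge may be given the colour of its left end. -/
theorem one_le_graphDensity_of_isMonotoneP3 {U : Type*} [LinearOrder U] [Finite U]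
    {F : SimpleGraph U} (hH : HasMonotonePath H) (hH' : HasMonotonePath H')
    (h : OrderedArrows F H H') : 1 ≤ graphDensity F := by
  refine one_le_graphDensity_of_not_isAcyclic fun hF => ?_
  obtain ⟨ρ⟩ := hF.colorable_two
  rcases h.exists_copy fun u _ => ρ u = 0 with ⟨g, hg⟩ | ⟨g, hg⟩
  · obtain ⟨a, b, c, hab, hbc, h1, h2⟩ := hH
    have k1 := hg a b hab h1
    exact ρ.valid k1.1 (k1.2.trans (hg b c hbc h2).2.symm)
  · obtain ⟨a, b, c, hab, hbc, h1, h2⟩ := hH'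
    have k1 := hg a b hab h1
    have k2 := hg b c hbc h2
    refine ρ.valid k1.1 ?_
    have := k1.2
    have := k2.2
    omega

/-- The triangle on `1, 2, 3` with the pendant edges `01` and `34`. -/
def triangleWithTails : SimpleGraph (Fin 5) :=
  SimpleGraph.fromEdgeSet {s(0, 1), s(1, 2), s(2, 3), s(1, 3), s(3, 4)}

theorem graphDensity_triangleWithTails_le : graphDensity triangleWithTails ≤ 1 := by
  refine graphDensity_le_one_of_map ![1, 2, 3, 1, 3] ?_
  simp only [triangleWithTails, SimpleGraph.fromEdgeSet_adj, Set.mem_insert_iff,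
    Set.mem_singleton_iff]
  decide

/-- Without a monochromatic monotone `P_3`, the edges `12` and `13` both have the colour that `01`
does not have, hence `23` has the colour of `01`; then `13` and `23` differ, so that no colour
is left for `34`. -/
theorem orderedArrows_triangleWithTails (hH : IsMonotoneP3 H) (hH' : IsMonotoneP3 H') :
    OrderedArrows triangleWithTails H H' := by
  intro c
  by_contra! hno
  have hcol : ∀ b, ¬ HasMonotonePath (c.labelGraph b) := by
    rintro (_ | _) hb
    · exact hno.2 (hH'.orderedContained hb)
    · exact hno.1 (hH.orderedContained hb)
  have a01 : triangleWithTails.Adj 0 1 := by simp [triangleWithTails]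
  have a12 : triangleWithTails.Adj 1 2 := by simp [triangleWithTails]
  have a23 : triangleWithTails.Adj 2 3 := by simp [triangleWithTails]
  have a13 : triangleWithTails.Adj 1 3 := by simp [triangleWithTails]
  have a34 : triangleWithTails.Adj 3 4 := by simp [triangleWithTails]
  have key : ∀ x y z, ∀ hxy : triangleWithTails.Adj x y, ∀ hyz : triangleWithTails.Adj y z,
      x < y → y < z → c ⟨s(x, y), hxy⟩ ≠ c ⟨s(y, z), hyz⟩ := by
    intro x y z hxy hyz lxy lyz heq
    exact hcol _ ⟨x, y, z, lxy, lyz, (SimpleGraph.EdgeLabeling.labelGraph_adj _ _).2 ⟨hxy, rfl⟩,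
      (SimpleGraph.EdgeLabeling.labelGraph_adj _ _).2 ⟨hyz, heq.symm⟩⟩
  have k1 := key 0 1 2 a01 a12 (by decide) (by decide)
  have k2 := key 0 1 3 a01 a13 (by decide) (by decide)
  have k3 := key 1 2 3 a12 a23 (by decide) (by decide)
  have k4 := key 1 3 4 a13 a34 (by decide) (by decide)
  have k5 := key 2 3 4 a23 a34 (by decide) (by decide)
  generalize c ⟨s(0, 1), a01⟩ = c01 at *
  generalize c ⟨s(1, 2), a12⟩ = c12 at *
  generalize c ⟨s(2, 3), a23⟩ = c23 at *
  generalize c ⟨s(1, 3), a13⟩ = c13 at *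
  generalize c ⟨s(3, 4), a34⟩ = c34 at *
  revert c01 c12 c23 c13 c34
  decide

theorem orderedRamseyDensity_eq_one_of_isMonotoneP3 (hH : IsMonotoneP3 H) (hH' : IsMonotoneP3 H') :
    orderedRamseyDensity H H' = 1 :=
  le_antisymm
    ((orderedRamseyDensity_le (orderedArrows_triangleWithTails hH hH')).trans
      graphDensity_triangleWithTails_le)
    (le_orderedRamseyDensity ⟨⟨5, _⟩, orderedArrows_triangleWithTails hH hH'⟩ fun _ hF =>
      one_le_graphDensity_of_isMonotoneP3 hH.hasMonotonePath hH'.hasMonotonePath hF)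

/-! ### Pairs with `K_2` -/

/-- Ramsey graphs for `K_2` and `H'` contain `H'`: colour all edges blue. -/
theorem OrderedArrows.orderedContained_of_edge {U : Type*} [LinearOrder U] {F : SimpleGraph U}
    (h : OrderedArrows F H H') (heH : H.edgeSet.Nonempty) : OrderedContained H' F := by
  rcases h.exists_copy fun _ _ => False with ⟨g, hg⟩ | ⟨g, hg⟩
  · obtain ⟨a, b, hab, hadj⟩ := exists_lt_adj heH
    exact (hg a b hab hadj).2.elim
  · refine ⟨g, fun u v huv => ?_⟩
    rcases lt_or_gt_of_ne huv.ne with hlt | hlt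
    · exact (hg u v hlt huv).1
    · exact (hg v u hlt huv.symm).1.symm

theorem IsOrderedK2.orderedArrows (hK : IsOrderedK2 H) : OrderedArrows H' H H' := by
  intro c
  by_cases hred : ∃ u v, (c.labelGraph true).Adj u v
  · obtain ⟨u, v, huv⟩ := hred
    exact Or.inl (hK.orderedContained huv)
  · refine Or.inr ⟨RelEmbedding.refl _, fun u v huv => ?_⟩
    refine (SimpleGraph.EdgeLabeling.labelGraph_adj _ _).2 ⟨huv, Bool.eq_false_of_not_eq_true ?_⟩
    exact fun h => hred ⟨u, v, (SimpleGraph.EdgeLabeling.labelGraph_adj _ _).2 ⟨huv, h⟩⟩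

/-- `H'` is itself a sparsest Ramsey graph for `K_2` and `H'`. -/
theorem IsOrderedK2.orderedRamseyDensity_eq [Finite W] (hK : IsOrderedK2 H)
    (heH : H.edgeSet.Nonempty) :
    orderedRamseyDensity H H' = graphDensity H' := by
  have := Fintype.ofFinite W
  refine le_antisymm (orderedRamseyDensity_le hK.orderedArrows) (le_orderedRamseyDensity
    ⟨⟨_, _⟩, hK.orderedArrows.comap (monoEquivOfFin W rfl)⟩ fun F hF => ?_)
  exact (OrderedArrows.orderedContained_of_edge hF heH).graphDensity_le

theorem IsOrderedK2.exists_pseudoforest [Finite W] (hK : IsOrderedK2 H)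
    (hH' : IsProperPseudoforest H') :
    ∃ F ∈ orderedRamseyGraphs H H', IsPseudoforest F.2 := by
  have := Fintype.ofFinite W
  let e := monoEquivOfFin W rfl
  exact ⟨⟨_, H'.comap e⟩, hK.orderedArrows.comap e, (OrderedContained.graphDensity_le
    ⟨e.toOrderEmbedding, fun _ _ h => h⟩).trans hH'.le⟩

end

theorem mainTheorem9 {V W : Type*} [LinearOrder V] [Finite V] [LinearOrder W] [Finite W]
    (H : SimpleGraph V) (H' : SimpleGraph W) (hH : H.Connected) (hH' : H'.Connected)
    (heH : H.edgeSet.Nonempty) (heH' : H'.edgeSet.Nonempty) :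
    (orderedRamseyDensity H H' = 1 ∧ ∃ F ∈ orderedRamseyGraphs H H', IsPseudoforest F.2) ↔
      ((IsOrderedK2 H ∧ IsProperPseudoforest H') ∨ (IsProperPseudoforest H ∧ IsOrderedK2 H')) ∨
        (IsMonotoneP3 H ∧ IsMonotoneP3 H') := by 
  constructor
  · rintro ⟨hd, ⟨n, F⟩, hF, hps⟩
    by_cases hK : IsOrderedK2 H
    · exact Or.inl (Or.inl ⟨hK, (hK.orderedRamseyDensity_eq heH).symm.trans hd⟩)
    by_cases hK' : IsOrderedK2 H'
    · exact Or.inl (Or.inr ⟨(hK'.orderedRamseyDensity_eq heH').symm.trans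
        ((orderedRamseyDensity_comm H' H).trans hd), hK'⟩)
    exact Or.inr (isMonotoneP3_of_pseudoforest hH hH' heH heH' hK hK' hF hps hd)
  · rintro ((⟨hK, hp⟩ | ⟨hp, hK⟩) | ⟨hM, hM'⟩)
    · exact ⟨(hK.orderedRamseyDensity_eq heH).trans hp, hK.exists_pseudoforest hp⟩
    · obtain ⟨F, hF, hF'⟩ := hK.exists_pseudoforest hp
      exact ⟨(orderedRamseyDensity_comm H H').trans ((hK.orderedRamseyDensity_eq heH').trans hp),
        F, OrderedArrows.symm hF, hF'⟩
    · exact ⟨orderedRamseyDensity_eq_one_of_isMonotoneP3 hM hM', ⟨5, triangleWithTails⟩,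
        orderedArrows_triangleWithTails hM hM', graphDensity_triangleWithTails_le⟩
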